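/- Let $R$ be a commutative Noetherian ring and let $C$ be a semidualizing $R$-module, that is, a finitely generated $R$-module such that the homothety map $R\to\operatorname{Hom}_R(C,C)$ is an isomorphism and $\operatorname{Ext}^i_R(C,C)=0$ for all $i>0$. For a complex $X$ of $R$-modules put $\sup X=\sup\{i\in\mathbb Z\mid X_i\neq 0\}$ and $\operatorname{hsup}X=\sup\{i\in\mathbb Z\mid H_i(X)\neq 0\}$. A $C$-quasi-projective resolution of an $R$-module $M$ is a bounded complex $P$ of projective $R$-modules such that $P\otimes_RC$ is not acyclic and, for every $i\in\mathbb Z$, $H_i(P\otimes_RC)\cong M^{\oplus a_i}$ for some integer $a_i\ge 0$. The $C$-quasi-projective dimension of $M\neq 0$ is $$\operatorname{cqpd}_C M=\inf\{\sup(P\otimes_RC)-\operatorname{hsup}(P\otimes_RC)\mid P\text{ is a } C\text{-quasi-projective resolution of }M\},$$ which is $\infty$ if $M$ has no such resolution, and $\operatorname{cqpd}_C 0=-\infty$. Let $M$ and $N$ be (not necessarily finitely generated) $R$-modules with $\operatorname{cqpd}_C M<\infty$. (1) If $\operatorname{Tor}^R_i(C,N)=0$ for all $i>0$ and $\operatorname{Tor}^R_i(M,N)=0$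 for all sufficiently large $i$, then $\operatorname{Tor}^R_i(M,N)=0$ for all $i>\operatorname{cqpd}_C M$. (2) If $\operatorname{Ext}_R^i(C,N)=0$ for all $i>0$ and $\operatorname{Ext}_R^i(M,N)=0$ for all sufficiently large $i$, then $\operatorname{Ext}_R^i(M,N)=0$ for all $i>\operatorname{cqpd}_C M$. -/

import Mathlib

open CategoryTheory MonoidalCategory

universe u

noncomputable section

namespace CQuasi

/-- The supremum `sup X = sup {i ∈ ℤ | X_i ≠ 0}` of a complex of modules, in the extended reals. -/
def sup {R : Type u} [CommRing R] (X : ChainComplex (ModuleCat.{u} R) ℤ) : EReal :=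
  ⨆ (i : ℤ) (_ : Nontrivial (X.X i)), ((i : ℝ) : EReal)

/-- The homological supremum `hsup X = sup {i ∈ ℤ | H_i(X) ≠ 0}` of a complex of modules. -/
def hsup {R : Type u} [CommRing R] (X : ChainComplex (ModuleCat.{u} R) ℤ) : EReal :=
  ⨆ (i : ℤ) (_ : Nontrivial (X.homology i)), ((i : ℝ) : EReal)

/-- A complex is bounded if only degrees in a finite interval carry a nonzero module. -/
def IsBounded {R : Type u} [CommRing R] (X : ChainComplex (ModuleCat.{u} R) ℤ) : Prop :=
  ∃ a b : ℤ, ∀ i : ℤ, Nontrivial (X.X i) → a ≤ i ∧ i ≤ b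

/-- The complex `P ⊗_R C`, for a complex `P` and a module `C`. -/
def tensorComplex {R : Type u} [CommRing R] (P : ChainComplex (ModuleCat.{u} R) ℤ)
    (C : ModuleCat.{u} R) : ChainComplex (ModuleCat.{u} R) ℤ :=
  ((tensorRight C).mapHomologicalComplex (ComplexShape.down ℤ)).obj P

/-- Semidualizing modules: finitely generated, the homothety map `R → Hom_R(C, C)` is
bijective, and `Ext^i_R(C, C) = 0` for all `i > 0`. -/
structure IsSemidualizing {R : Type u} [CommRing R] (C : ModuleCat.{u} R) : Prop where
  finite : Module.Finite R C
  homothety_bijective : Function.Bijective (LinearMap.lsmul R C)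
  ext_eq_zero : ∀ i : ℕ, 0 < i → Subsingleton (Abelian.Ext.{u} C C i)

/-- `C`-quasi-projective resolutions of `M`: bounded complexes `P` of projective modules such
that `P ⊗_R C` is not acyclic and each of its homology modules is isomorphic to a finite direct
sum `M^a` (with `a = 0` allowed). -/
structure IsCQuasiProjectiveResolution {R : Type u} [CommRing R] (C M : ModuleCat.{u} R)
    (P : ChainComplex (ModuleCat.{u} R) ℤ) : Prop where
  bounded : IsBounded P
  projective : ∀ i : ℤ, Module.Projective R (P.X i)
  not_acyclic : ¬ (tensorComplex P C).Acyclic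
  homology_iso : ∀ i : ℤ, ∃ a : ℕ,
    Nonempty ((tensorComplex P C).homology i ≅ ModuleCat.of R (Fin a → M))

open Classical in
/-- The `C`-quasi-projective dimension of `M`. It is `⊥` (that is, `-∞`) for the zero module, and
`⊤` (that is, `∞`) for a nonzero module without `C`-quasi-projective resolution. -/
def cqpd {R : Type u} [CommRing R] (C M : ModuleCat.{u} R) : EReal :=
  if Subsingleton M then ⊥
  else ⨅ (P : ChainComplex (ModuleCat.{u} R) ℤ) (_ : IsCQuasiProjectiveResolution C M P),
    sup (tensorComplex P C) - hsup (tensorComplex P C)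

/-- `Tor_i^R(M, N) = 0`. -/
def TorVanishes {R : Type u} [CommRing R] (M N : ModuleCat.{u} R) (i : ℕ) : Prop :=
  Limits.IsZero (((Tor (ModuleCat.{u} R) i).obj M).obj N)

/-- `Ext^i_R(M, N) = 0`. -/
def ExtVanishes {R : Type u} [CommRing R] (M N : ModuleCat.{u} R) (i : ℕ) : Prop :=
  Subsingleton (Abelian.Ext.{u} M N i)

end CQuasi

end

-- Put `X = P ⊗ C`, with `s = sup X` and `h = hsup X`, and let `V i` stand for vanishing of
-- `Tor_i(-, N)` or `Ext^i(-, N)`; only long exact sequences, retracts and zero objects matter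
-- (`IsVanishingFamily`). The terms of `X` satisfy `V i` for `i > 0`. Suppose `n > s - h` and `V i
-- M` holds for all `i > n`. Climbing from the bottom of `X` through cycles and boundaries gives `V
-- n` on the cycles in degree `h` (`vanishing_cycles_boundaries`). Above `h` the complex is exact,
-- so it resolves the boundaries in degree `h`, which gives `V (n - 1)` on them
-- (`vanishing_boundaries_of_homology_eq_zero`). Hence `V n` holds on the homology in degree `h`, a
-- nonzero finite power of `M`, so on `M`. Descending induction on `n` ends the proof.

universe v w

namespace CQuasi

open Limits

/-! ### Dimension shifting along cycles and boundaries -/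

section Abstract

variable {A : Type w} [Category.{v} A] [Abelian A]

/-- A family of classes of objects that behaves like the vanishing of a (contravariant or
covariant) homological functor, where short exact sequences give long exact sequences
in which `V i S.X₁` is followed or preceded by `V (i + 1) S.X₃`. -/
structure IsVanishingFamily (V : ℕ → A → Prop) : Prop where
  of_isZero : ∀ {i : ℕ} {X : A}, IsZero X → V i X
  of_retract : ∀ {i : ℕ} {X Y : A}, Retract X Y → V i Y → V i X
  left : ∀ {i : ℕ} {S : ShortComplex A}, S.ShortExact → V i S.X₂ → V (i + 1) S.X₃ → V i S.X₁
  middle : ∀ {i : ℕ} {S : ShortComplex A}, S.ShortExact → V i S.X₁ → V i S.X₃ → V i S.X₂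
  right : ∀ {i : ℕ} {S : ShortComplex A}, S.ShortExact →
    V (i + 1) S.X₂ → V i S.X₁ → V (i + 1) S.X₃

variable (X : ChainComplex A ℤ)

/-- The boundaries in degree `j`, as the kernel of the projection from cycles to homology. -/
noncomputable abbrev boundaries (j : ℤ) : A := kernel (X.homologyπ j)

lemma shortExact_boundaries_cycles_homology (j : ℤ) :
    (ShortComplex.mk (kernel.ι (X.homologyπ j)) (X.homologyπ j)
      (kernel.condition _)).ShortExact :=
  { exact := ShortComplex.exact_kernel _ }

lemma iCycles_comp_lift_toCycles (j : ℤ) :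
    X.iCycles (j + 1) ≫ kernel.lift (X.homologyπ j) (X.toCycles (j + 1) j) (by simp) = 0 := by
  rw [← cancel_mono (kernel.ι _), ← cancel_mono (X.iCycles j)]
  simp

lemma shortExact_cycles_boundaries (j : ℤ) :
    (ShortComplex.mk (X.iCycles (j + 1))
      (kernel.lift (X.homologyπ j) (X.toCycles (j + 1) j) (by simp))
      (iCycles_comp_lift_toCycles X j)).ShortExact := by
  have hprev : (ComplexShape.down ℤ).prev j = j + 1 := by simp
  have hnext : (ComplexShape.down ℤ).next (j + 1) = j := by simp
  have hE : (ShortComplex.mk (X.toCycles (j + 1) j) (X.homologyπ j) (by simp)).Exact :=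
    ShortComplex.exact_of_g_is_cokernel _ (X.homologyIsCokernel _ _ hprev)
  have hK : (ShortComplex.mk (X.iCycles (j + 1)) (X.d (j + 1) j) (by simp)).Exact :=
    ShortComplex.exact_of_f_is_kernel _ (X.cyclesIsKernel _ _ hnext)
  have : Epi (kernel.lift (X.homologyπ j) (X.toCycles (j + 1) j) (by simp)) :=
    hE.epi_kernelLift
  refine ⟨?_⟩
  -- Exactness is pulled back from `Z_{j+1} → X_{j+1} → X_j`, since `B_j → X_j` is mono.
  let φ : ShortComplex.mk (X.iCycles (j + 1))
      (kernel.lift (X.homologyπ j) (X.toCycles (j + 1) j) (by simp))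
      (iCycles_comp_lift_toCycles X j) ⟶
      ShortComplex.mk (X.iCycles (j + 1)) (X.d (j + 1) j) (by simp) :=
    { τ₁ := 𝟙 _, τ₂ := 𝟙 _, τ₃ := kernel.ι _ ≫ X.iCycles j }
  have : Epi φ.τ₁ := inferInstanceAs (Epi (𝟙 _))
  have : IsIso φ.τ₂ := inferInstanceAs (IsIso (𝟙 _))
  have : Mono φ.τ₃ := inferInstanceAs (Mono (kernel.ι _ ≫ X.iCycles j))
  exact (ShortComplex.exact_iff_of_epi_of_isIso_of_mono φ).2 hK

lemma isZero_cycles {j : ℤ} (h : IsZero (X.X j)) : IsZero (X.cycles j) :=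
  h.of_mono (X.iCycles j)

lemma isZero_boundaries {j : ℤ} (h : IsZero (X.X j)) : IsZero (boundaries X j) :=
  (isZero_cycles X h).of_mono (kernel.ι _)

lemma isZero_boundaries_of_succ {j : ℤ} (h : IsZero (X.X (j + 1))) :
    IsZero (boundaries X j) :=
  have := (shortExact_cycles_boundaries X j).epi_g
  h.of_epi (kernel.lift (X.homologyπ j) (X.toCycles (j + 1) j) _)

lemma isZero_homology {j : ℤ} (h : IsZero (X.X j)) : IsZero (X.homology j) :=
  (isZero_cycles X h).of_epi (X.homologyπ j)

variable {X} {V : ℕ → A → Prop} (hV : IsVanishingFamily V)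

include hV

/-- Each step up costs one index, `V (i + 1)` giving `V i`; nothing is lost because all `i ≥ n` are
treated at once. Homology enters only at `i + 1 > n`. -/
lemma vanishing_cycles_boundaries (hX : ∀ (j : ℤ) (i : ℕ), 0 < i → V i (X.X j))
    {n : ℕ} (hn : 0 < n) (hH : ∀ (j : ℤ) (i : ℕ), n < i → V i (X.homology j))
    {a : ℤ} (ha : IsZero (X.X a)) (k i : ℕ) (hi : n ≤ i) :
    V i (X.cycles (a + k)) ∧ V i (boundaries X (a + k)) := by
  induction k generalizing i with
  | zero =>
    simp only [Nat.cast_zero, add_zero]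
    exact ⟨hV.of_isZero (isZero_cycles X ha), hV.of_isZero (isZero_boundaries X ha)⟩
  | succ k ih =>
    rw [Nat.cast_succ, ← add_assoc]
    have hZ : V i (X.cycles (a + k + 1)) :=
      hV.left (shortExact_cycles_boundaries X (a + k)) (hX _ _ (hn.trans_le hi))
        (ih (i + 1) (by omega)).2
    exact ⟨hZ, hV.left (shortExact_boundaries_cycles_homology X _) hZ (hH _ _ (by omega))⟩

/-- For `h ≤ j < s`, `X_s → ⋯ → X_{j+1}` resolves `B_j` with length `s - j - 1`, so `V i` holds on
`B_j` beyond that length. -/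
lemma vanishing_boundaries_of_homology_eq_zero
    (hX : ∀ (j : ℤ) (i : ℕ), 0 < i → V i (X.X j))
    {s h : ℤ} (hs : ∀ j, s < j → IsZero (X.X j)) (hh : ∀ j, h < j → IsZero (X.homology j))
    (k : ℕ) (j : ℤ) (hj : h ≤ j) (hk : s - j ≤ k) (i : ℕ) (hi : s - j ≤ i) :
    V i (boundaries X j) := by
  induction k generalizing i j with
  | zero => exact hV.of_isZero (isZero_boundaries_of_succ X (hs _ (by omega)))
  | succ k ih =>
    by_cases hjs : s ≤ j
    · exact hV.of_isZero (isZero_boundaries_of_succ X (hs _ (by omega)))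
    obtain ⟨i, rfl⟩ : ∃ m, i = m + 1 := ⟨i - 1, by omega⟩
    refine hV.right (shortExact_cycles_boundaries X j) (hX _ _ (by omega)) ?_
    exact hV.middle (shortExact_boundaries_cycles_homology X _)
      (ih (j + 1) (by omega) (by omega) i (by omega)) (hV.of_isZero (hh _ (by omega)))

/-- Vanishing of the top homology in degree `n`, from vanishing of all homology in the degrees
above `n`, as soon as `n` exceeds the distance between `s ≥ sup X` and `h ≥ hsup X`. -/
lemma vanishing_homology (hX : ∀ (j : ℤ) (i : ℕ), 0 < i → V i (X.X j))
    {a s h : ℤ} (ha : ∀ j, j < a → IsZero (X.X j))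
    (hs : ∀ j, s < j → IsZero (X.X j)) (hh : ∀ j, h < j → IsZero (X.homology j))
    {n : ℕ} (hn : 0 < n) (hsn : s - h < n)
    (hH : ∀ (j : ℤ) (i : ℕ), n < i → V i (X.homology j)) :
    V n (X.homology h) := by
  by_cases hah : h < a
  · exact hV.of_isZero (isZero_homology X (ha _ hah))
  obtain ⟨k, hk⟩ : ∃ k : ℕ, h = a - 1 + k := ⟨(h - a + 1).toNat, by omega⟩
  have hZ : V n (X.cycles h) :=
    hk ▸ (vanishing_cycles_boundaries hV hX hn hH (ha (a - 1) (by omega)) k n le_rfl).1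
  obtain ⟨n, rfl⟩ : ∃ m, n = m + 1 := ⟨n - 1, by omega⟩
  exact hV.right (shortExact_boundaries_cycles_homology X h) hZ
    (vanishing_boundaries_of_homology_eq_zero hV hX hs hh (s - h).toNat h le_rfl
      (by omega) n (by omega))

end Abstract

/-! ### Powers of a module and the descending induction -/

section Module

variable {R : Type u} [CommRing R]

/-- A linear retraction, as a retract in the category of modules. -/
noncomputable def retractOfLinearMap {M K : Type u} [AddCommGroup M] [Module R M]
    [AddCommGroup K] [Module R K] (f : M →ₗ[R] K) (g : K →ₗ[R] M) (h : g ∘ₗ f = .id) :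
    Retract (ModuleCat.of R M) (ModuleCat.of R K) where
  i := ModuleCat.ofHom f
  r := ModuleCat.ofHom g
  retract := by rw [← ModuleCat.ofHom_comp, h, ModuleCat.ofHom_id]

variable {V : ℕ → ModuleCat.{u} R → Prop} (hV : IsVanishingFamily V)

include hV

lemma IsVanishingFamily.prod {i : ℕ} {M K : Type u} [AddCommGroup M] [Module R M]
    [AddCommGroup K] [Module R K] (hM : V i (ModuleCat.of R M)) (hK : V i (ModuleCat.of R K)) :
    V i (ModuleCat.of R (M × K)) := by
  have hS : (ShortComplex.mk (ModuleCat.ofHom (LinearMap.inl R M K))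
      (ModuleCat.ofHom (LinearMap.snd R M K)) (by ext; simp)).ShortExact :=
    { exact := by
        rw [ShortComplex.ShortExact.moduleCat_exact_iff_function_exact]
        exact Function.Exact.inl_snd
      mono_f := (ModuleCat.mono_iff_injective _).2 LinearMap.inl_injective
      epi_g := (ModuleCat.epi_iff_surjective _).2 LinearMap.snd_surjective }
  exact hV.middle hS hM hK

lemma IsVanishingFamily.pi {i : ℕ} {M : ModuleCat.{u} R} (hM : V i M) (a : ℕ) :
    V i (ModuleCat.of R (Fin a → M)) := by
  induction a with
  | zero => exact hV.of_isZero (ModuleCat.isZero_of_subsingleton _)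
  | succ a ih =>
    have e := Fin.consLinearEquiv R (fun _ : Fin (a + 1) => M)
    exact hV.of_retract (retractOfLinearMap e.symm.toLinearMap e.toLinearMap (by ext; simp))
      (hV.prod hM ih)

lemma IsVanishingFamily.of_pi {i : ℕ} {M : ModuleCat.{u} R} {a : ℕ} (ha : a ≠ 0)
    (h : V i (ModuleCat.of R (Fin a → M))) : V i M :=
  hV.of_retract (retractOfLinearMap (LinearMap.pi fun _ => .id)
    (LinearMap.proj (⟨0, Nat.pos_of_ne_zero ha⟩ : Fin a)) (by ext; simp)) h

lemma vanishing_of_homology_iso_pi {M : ModuleCat.{u} R} {X : ChainComplex (ModuleCat.{u} R) ℤ}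
    (hX : ∀ (j : ℤ) (i : ℕ), 0 < i → V i (X.X j))
    (hM : ∀ j : ℤ, ∃ a : ℕ, Nonempty (X.homology j ≅ ModuleCat.of R (Fin a → M)))
    {a s h : ℤ} (ha : ∀ j, j < a → IsZero (X.X j)) (hs : ∀ j, s < j → IsZero (X.X j))
    (hh : ∀ j, h < j → IsZero (X.homology j)) (hh0 : Nontrivial (X.homology h))
    (hev : ∃ n : ℕ, ∀ i : ℕ, n ≤ i → V i M) {n : ℕ} (hsn : s - h < n) : V n M := by
  -- This makes every index `i > s - h` positive.
  have hsh : h ≤ s := by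
    by_contra! hlt
    exact not_subsingleton (X.homology h)
      (ModuleCat.subsingleton_of_isZero (isZero_homology X (hs _ hlt)))
  obtain ⟨m, hm⟩ := hev
  -- `k` bounds how far `i` lies below the threshold `m`.
  suffices H : ∀ k i : ℕ, m ≤ i + k → s - h < i → V i M from H m n (by omega) hsn
  intro k
  induction k with
  | zero => exact fun i hi _ => hm i hi
  | succ k ih =>
    intro i hi hsi
    have hH : V i (X.homology h) := by
      refine vanishing_homology hV hX ha hs hh (by omega) hsi fun j l hl => ?_
      obtain ⟨b, ⟨e⟩⟩ := hM j
      exact hV.of_retract (Retract.ofIso e) (hV.pi (ih l (by omega) (by omega)) b)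
    obtain ⟨b, ⟨e⟩⟩ := hM h
    refine hV.of_pi (a := b) ?_ (hV.of_retract (Retract.ofIso e.symm) hH)
    -- An empty power would make the homology in degree `h` zero.
    rintro rfl
    exact not_subsingleton (X.homology h) e.toLinearEquiv.subsingleton

end Module

/-! ### Tor as a vanishing family -/

section Tor

variable {R : Type u} [CommRing R]

/-- The functor `M ↦ M ⊗ Q` to complexes. -/
noncomputable def tensorWithComplex (Q : ChainComplex (ModuleCat.{u} R) ℕ) :
    ModuleCat.{u} R ⥤ ChainComplex (ModuleCat.{u} R) ℕ where
  obj M := ((tensorLeft M).mapHomologicalComplex _).obj Q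
  map f := (NatTrans.mapHomologicalComplex ((tensoringLeft (ModuleCat.{u} R)).map f) _).app Q

instance (Q : ChainComplex (ModuleCat.{u} R) ℕ) :
    (tensorWithComplex Q).PreservesZeroMorphisms where
  map_zero X Y := by
    ext i : 1
    exact MonoidalPreadditive.zero_whiskerRight

lemma shortExact_tensorWithComplex (Q : ChainComplex (ModuleCat.{u} R) ℕ)
    (hQ : ∀ i, Module.Flat R (Q.X i)) {S : ShortComplex (ModuleCat.{u} R)} (hS : S.ShortExact) :
    (S.map (tensorWithComplex Q)).ShortExact := by
  apply HomologicalComplex.shortExact_of_degreewise_shortExact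
  intro i
  have := hQ i
  have hm := hS.mono_f
  have he := hS.epi_g
  exact
    { exact := Module.Flat.rTensor_shortComplex_exact (Q.X i) S hS.exact
      mono_f := (ModuleCat.mono_iff_injective _).2
        (Module.Flat.rTensor_preserves_injective_linearMap S.f.hom
          ((ModuleCat.mono_iff_injective _).1 hm))
      epi_g := (ModuleCat.epi_iff_surjective _).2
        (LinearMap.rTensor_surjective (Q.X i) ((ModuleCat.epi_iff_surjective _).1 he)) }

lemma isZero_of_retract {A : Type w} [Category.{v} A] [HasZeroMorphisms A] {X Y : A}
    (r : Retract X Y) (hY : IsZero Y) : IsZero X :=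
  hY.of_mono r.i

/-- `Tor` is derived in its second variable; exactness in the first comes from tensoring with a flat
complex and taking the homology sequence. -/
lemma isVanishingFamily_homology_tensorWithComplex (Q : ChainComplex (ModuleCat.{u} R) ℕ)
    (hQ : ∀ i, Module.Flat R (Q.X i)) :
    IsVanishingFamily fun i (M : ModuleCat.{u} R) =>
      IsZero (((tensorWithComplex Q).obj M).homology i) where
  of_isZero {i X} hX :=
    ((tensorWithComplex Q ⋙ HomologicalComplex.homologyFunctor _ _ i).map_isZero hX)
  of_retract {i X Y} r hY :=
    isZero_of_retract
      (r.map (tensorWithComplex Q ⋙ HomologicalComplex.homologyFunctor _ _ i)) hY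
  left {i S} hS h₂ h₃ :=
    ((shortExact_tensorWithComplex Q hQ hS).homology_exact₁ (i + 1) i (by simp)).isZero_X₂
      (h₃.eq_of_src _ _) (h₂.eq_of_tgt _ _)
  middle {i S} hS h₁ h₃ :=
    ((shortExact_tensorWithComplex Q hQ hS).homology_exact₂ i).isZero_X₂
      (h₁.eq_of_src _ _) (h₃.eq_of_tgt _ _)
  right {i S} hS h₂ h₁ :=
    ((shortExact_tensorWithComplex Q hQ hS).homology_exact₃ (i + 1) i (by simp)).isZero_X₂
      (h₂.eq_of_src _ _) (h₁.eq_of_tgt _ _)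

lemma torVanishes_iff (M : ModuleCat.{u} R) {N : ModuleCat.{u} R} (Q : ProjectiveResolution N)
    (i : ℕ) :
    TorVanishes M N i ↔ IsZero (((tensorWithComplex Q.complex).obj M).homology i) :=
  (Q.isoLeftDerivedObj ((tensoringLeft (ModuleCat.{u} R)).obj M) i).isZero_iff

lemma isVanishingFamily_torVanishes (N : ModuleCat.{u} R) :
    IsVanishingFamily fun i (M : ModuleCat.{u} R) => TorVanishes M N i := by
  have h := isVanishingFamily_homology_tensorWithComplex (projectiveResolution N).complex
    fun i => by
      have : Module.Projective R ((projectiveResolution N).complex.X i) :=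
        (IsProjective.iff_projective _).2 ((projectiveResolution N).projective i)
      infer_instance
  have e : (fun i (M : ModuleCat.{u} R) => TorVanishes M N i) = fun i M =>
      IsZero (((tensorWithComplex (projectiveResolution N).complex).obj M).homology i) :=
    funext₂ fun i M => propext (torVanishes_iff M (projectiveResolution N) i)
  rwa [e]

lemma exactAt_mapHomologicalComplex_tensorLeft {K : ChainComplex (ModuleCat.{u} R) ℕ} {i : ℕ}
    (h : K.ExactAt i) (P : ModuleCat.{u} R) [Module.Flat R P] :
    (((tensorLeft P).mapHomologicalComplex _).obj K).ExactAt i :=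
  Module.Flat.lTensor_shortComplex_exact P (K.sc i) h

/-- `(P ⊗ C) ⊗ Q ≅ P ⊗ (C ⊗ Q)`, and `P ⊗ -` is exact. -/
lemma exactAt_tensorWithComplex_tensor {Q : ChainComplex (ModuleCat.{u} R) ℕ}
    {C : ModuleCat.{u} R} {i : ℕ} (h : ((tensorWithComplex Q).obj C).ExactAt i)
    (P : ModuleCat.{u} R) [Module.Flat R P] :
    ((tensorWithComplex Q).obj (P ⊗ C)).ExactAt i := by
  have hP : (((tensorLeft P).mapHomologicalComplex _).obj
      ((tensorWithComplex Q).obj C)).ExactAt i :=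
    exactAt_mapHomologicalComplex_tensorLeft h P
  let e := (NatIso.mapHomologicalComplex (tensorLeftTensor P C) (ComplexShape.down ℕ)).app Q
  exact hP.of_iso e.symm

lemma TorVanishes.tensor_left {C N : ModuleCat.{u} R} {i : ℕ} (h : TorVanishes C N i)
    (P : ModuleCat.{u} R) [Module.Flat R P] : TorVanishes (P ⊗ C) N i := by
  have h' := (torVanishes_iff C (projectiveResolution N) i).1 h
  rw [← HomologicalComplex.exactAt_iff_isZero_homology] at h'
  refine (torVanishes_iff (P ⊗ C) (projectiveResolution N) i).2 ?_
  rw [← HomologicalComplex.exactAt_iff_isZero_homology]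
  exact exactAt_tensorWithComplex_tensor h' P

end Tor

/-! ### Ext as a vanishing family -/

section Ext

open Abelian

variable {R : Type u} [CommRing R]

lemma isVanishingFamily_extVanishes (N : ModuleCat.{u} R) :
    IsVanishingFamily fun i (M : ModuleCat.{u} R) => ExtVanishes M N i where
  of_isZero {i X} hX := subsingleton_of_forall_eq 0 fun e => by
    rw [← Ext.mk₀_id_comp e, hX.eq_of_src (𝟙 X) 0, Ext.mk₀_zero, Ext.zero_comp]
  of_retract {i X Y} r hY := subsingleton_of_forall_eq 0 fun e => by
    have hY : Subsingleton (Ext.{u} Y N i) := hY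
    rw [← Ext.mk₀_id_comp e, ← r.retract, ← Ext.mk₀_comp_mk₀_assoc,
      Subsingleton.elim ((Ext.mk₀ r.r).comp e _) 0, Ext.comp_zero]
  left {i S} hS h₂ h₃ := subsingleton_of_forall_eq 0 fun e => by
    have h₂ : Subsingleton (Ext.{u} S.X₂ N i) := h₂
    have h₃ : Subsingleton (Ext.{u} S.X₃ N (i + 1)) := h₃
    obtain ⟨x, rfl⟩ := Ext.contravariant_sequence_exact₁ hS N e (add_comm 1 i)
      (Subsingleton.elim _ _)
    rw [Subsingleton.elim x 0, Ext.comp_zero]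
  middle {i S} hS h₁ h₃ := subsingleton_of_forall_eq 0 fun e => by
    have h₁ : Subsingleton (Ext.{u} S.X₁ N i) := h₁
    have h₃ : Subsingleton (Ext.{u} S.X₃ N i) := h₃
    obtain ⟨x, rfl⟩ := Ext.contravariant_sequence_exact₂ hS N e (Subsingleton.elim _ _)
    rw [Subsingleton.elim x 0, Ext.comp_zero]
  right {i S} hS h₂ h₁ := subsingleton_of_forall_eq 0 fun e => by
    have h₂ : Subsingleton (Ext.{u} S.X₂ N (i + 1)) := h₂
    have h₁ : Subsingleton (Ext.{u} S.X₁ N i) := h₁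
    obtain ⟨x, rfl⟩ := Ext.contravariant_sequence_exact₃ hS N e (Subsingleton.elim _ _)
      (add_comm 1 i)
    rw [Subsingleton.elim x 0, Ext.comp_zero]

/-- If every map `C ⟶ K` lifts along `p : I ⟶ K`, so does every map `P ⊗ C ⟶ K`,
for `P` projective. -/
lemma exists_lift_tensor (P : ModuleCat.{u} R) [Module.Projective R P] {C I K : ModuleCat.{u} R}
    (p : I ⟶ K) (h : ∀ f : C ⟶ K, ∃ g : C ⟶ I, g ≫ p = f) (f : P ⊗ C ⟶ K) :
    ∃ g : P ⊗ C ⟶ I, g ≫ p = f := by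
  -- By adjunction the task is to lift `P → Hom(C, K)` along `Hom(C, I) → Hom(C, K)`.
  have hsurj : Function.Surjective (LinearMap.llcomp R C I K p.hom) := fun φ => by
    obtain ⟨g, hg⟩ := h (ModuleCat.ofHom φ)
    exact ⟨g.hom, congrArg ModuleCat.Hom.hom hg⟩
  obtain ⟨γ, hγ⟩ := Module.projective_lifting_property _ (TensorProduct.curry f.hom) hsurj
  refine ⟨ModuleCat.ofHom (TensorProduct.lift γ), ?_⟩
  ext : 1
  refine TensorProduct.ext' fun x c => ?_
  exact congrArg (fun φ : C →ₗ[R] K => φ c) (LinearMap.congr_fun hγ x)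

lemma extVanishes_one_iff {S : ShortComplex (ModuleCat.{u} R)} (hS : S.ShortExact)
    [Injective S.X₂] (M : ModuleCat.{u} R) :
    ExtVanishes M S.X₁ 1 ↔ ∀ f : M ⟶ S.X₃, ∃ g : M ⟶ S.X₂, g ≫ S.g = f := by
  constructor
  · intro h f
    have h : Subsingleton (Ext.{u} M S.X₁ 1) := h
    obtain ⟨x, hx⟩ := Ext.covariant_sequence_exact₃ M hS (Ext.mk₀ f) (zero_add 1)
      (Subsingleton.elim _ _)
    obtain ⟨g, rfl⟩ := Ext.homEquiv₀.symm.surjective x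
    exact ⟨g, Ext.homEquiv₀.symm.injective (by simpa using hx)⟩
  · intro h
    refine subsingleton_of_forall_eq 0 fun e => ?_
    obtain ⟨x, rfl⟩ := Ext.covariant_sequence_exact₁ M hS e (Ext.eq_zero_of_injective _)
      (zero_add 1)
    obtain ⟨f, rfl⟩ := Ext.homEquiv₀.symm.surjective x
    obtain ⟨g, rfl⟩ := h f
    simp [← Ext.mk₀_comp_mk₀]

lemma extVanishes_succ_succ_iff {S : ShortComplex (ModuleCat.{u} R)} (hS : S.ShortExact)
    [Injective S.X₂] (M : ModuleCat.{u} R) (i : ℕ) :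
    ExtVanishes M S.X₁ (i + 2) ↔ ExtVanishes M S.X₃ (i + 1) := by
  constructor
  · intro h
    have h : Subsingleton (Ext.{u} M S.X₁ (i + 2)) := h
    refine subsingleton_of_forall_eq 0 fun e => ?_
    obtain ⟨x, rfl⟩ := Ext.covariant_sequence_exact₃ M hS e rfl (Subsingleton.elim _ _)
    rw [Ext.eq_zero_of_injective x, Ext.zero_comp]
  · intro h
    have h : Subsingleton (Ext.{u} M S.X₃ (i + 1)) := h
    refine subsingleton_of_forall_eq 0 fun e => ?_
    obtain ⟨x, rfl⟩ := Ext.covariant_sequence_exact₁ M hS e (Ext.eq_zero_of_injective _) rfl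
    rw [Subsingleton.elim x 0, Ext.zero_comp]

lemma exists_shortExact_injective (N : ModuleCat.{u} R) :
    ∃ S : ShortComplex (ModuleCat.{u} R), S.ShortExact ∧ S.X₁ = N ∧ Injective S.X₂ := by
  obtain ⟨J⟩ := EnoughInjectives.presentation N
  exact ⟨ShortComplex.mk J.f (cokernel.π J.f) (cokernel.condition _),
    { exact := ShortComplex.exact_cokernel _ }, rfl, J.injective⟩

/-- Embedding `N` in an injective shifts the degree down to `Ext^1`, whose vanishing is a lifting
property that passes from `C` to `P ⊗ C`. -/
lemma ExtVanishes.tensor_left {C N : ModuleCat.{u} R} {i : ℕ} (h : ExtVanishes C N (i + 1))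
    (P : ModuleCat.{u} R) [Module.Projective R P] : ExtVanishes (P ⊗ C) N (i + 1) := by
  induction i generalizing N with
  | zero =>
    obtain ⟨S, hS, rfl, hI⟩ := exists_shortExact_injective N
    exact (extVanishes_one_iff hS _).2
      (exists_lift_tensor P _ ((extVanishes_one_iff hS C).1 h))
  | succ i ih =>
    obtain ⟨S, hS, rfl, hI⟩ := exists_shortExact_injective N
    exact (extVanishes_succ_succ_iff hS _ i).2 (ih ((extVanishes_succ_succ_iff hS C i).1 h))

end Ext

/-! ### From the infimum to a single resolution -/

section Dimension

variable {R : Type u} [CommRing R]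

lemma iSup_int_eq {p : ℤ → Prop} {s : ℤ} (hs : p s) (h : ∀ i, p i → i ≤ s) :
    (⨆ (i : ℤ) (_ : p i), ((i : ℝ) : EReal)) = ((s : ℝ) : EReal) :=
  le_antisymm (iSup₂_le fun i hi => by exact_mod_cast h i hi)
    (le_iSup₂_of_le s hs le_rfl)

lemma isZero_of_not_nontrivial {M : ModuleCat.{u} R} (h : ¬ Nontrivial M) : IsZero M :=
  have := not_nontrivial_iff_subsingleton.1 h
  ModuleCat.isZero_of_subsingleton M

lemma nontrivial_of_not_isZero {M : ModuleCat.{u} R} (h : ¬ IsZero M) : Nontrivial M :=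
  by_contra fun h' => h (isZero_of_not_nontrivial h')

lemma IsBounded.tensorComplex {P : ChainComplex (ModuleCat.{u} R) ℤ} (hP : IsBounded P)
    (C : ModuleCat.{u} R) : IsBounded (tensorComplex P C) := by
  obtain ⟨a, b, hab⟩ := hP
  refine ⟨a, b, fun i hi => hab i (nontrivial_of_not_isZero fun h => ?_)⟩
  exact not_subsingleton_iff_nontrivial.2 hi
    (ModuleCat.subsingleton_of_isZero ((tensorRight C).map_isZero h))

/-- The two suprema of a bounded complex that is not acyclic are integers. -/
lemma IsBounded.exists_sup_hsup {X : ChainComplex (ModuleCat.{u} R) ℤ} (hX : IsBounded X)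
    (hne : ¬ X.Acyclic) :
    ∃ a s h : ℤ, (∀ j, j < a → IsZero (X.X j)) ∧ (∀ j, s < j → IsZero (X.X j)) ∧
      (∀ j, h < j → IsZero (X.homology j)) ∧ Nontrivial (X.homology h) ∧
      sup X = ((s : ℝ) : EReal) ∧ hsup X = ((h : ℝ) : EReal) := by
  obtain ⟨a, b, hab⟩ := hX
  have hH : ∀ j, Nontrivial (X.homology j) → Nontrivial (X.X j) := fun j hj =>
    nontrivial_of_not_isZero fun h0 =>
      not_subsingleton (X.homology j) (ModuleCat.subsingleton_of_isZero (isZero_homology X h0))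
  obtain ⟨j, hj⟩ : ∃ j, Nontrivial (X.homology j) := by
    by_contra! hall
    exact hne fun j => (X.exactAt_iff_isZero_homology j).2
      (have := hall j; ModuleCat.isZero_of_subsingleton _)
  obtain ⟨s, hs, hs'⟩ := Int.exists_greatest_of_bdd (P := fun j => Nontrivial (X.X j))
    ⟨b, fun z hz => (hab z hz).2⟩ ⟨j, hH j hj⟩
  obtain ⟨h, hh, hh'⟩ := Int.exists_greatest_of_bdd (P := fun j => Nontrivial (X.homology j))
    ⟨b, fun z hz => (hab z (hH z hz)).2⟩ ⟨j, hj⟩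
  exact ⟨a, s, h, fun j hj => isZero_of_not_nontrivial fun h1 => hj.not_ge (hab j h1).1,
    fun j hj => isZero_of_not_nontrivial fun h1 => hj.not_ge (hs' j h1),
    fun j hj => isZero_of_not_nontrivial fun h1 => hj.not_ge (hh' j h1), hh,
    iSup_int_eq hs hs', iSup_int_eq hh hh'⟩

/-- A vanishing family that vanishes in positive degrees on all `P ⊗ C` with `P` projective and
eventually vanishes on `M` vanishes on `M` above `cqpd C M`. -/
lemma IsVanishingFamily.of_cqpd_lt {V : ℕ → ModuleCat.{u} R → Prop} (hV : IsVanishingFamily V)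
    {C M : ModuleCat.{u} R}
    (hC : ∀ (P : ModuleCat.{u} R) [Module.Projective R P] (i : ℕ), 0 < i → V i (P ⊗ C))
    (hev : ∃ n : ℕ, ∀ i : ℕ, n ≤ i → V i M) (i : ℕ) (hi : cqpd C M < ((i : ℝ) : EReal)) :
    V i M := by
  rw [cqpd] at hi
  split_ifs at hi with hM
  · exact hV.of_isZero (ModuleCat.isZero_of_subsingleton M)
  -- An infimum below `i` yields one resolution with value below `i`; attainment is not needed.
  simp only [iInf_lt_iff] at hi
  obtain ⟨P, hP, hlt⟩ := hi
  obtain ⟨a, s, h, ha, hs, hh, hh0, hsup, hhsup⟩ :=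
    (hP.bounded.tensorComplex C).exists_sup_hsup hP.not_acyclic
  rw [hsup, hhsup, ← EReal.coe_sub, EReal.coe_lt_coe_iff] at hlt
  exact vanishing_of_homology_iso_pi hV
    (fun j i hi => have := hP.projective j; hC (P.X j) i hi)
    hP.homology_iso ha hs hh hh0 hev (by exact_mod_cast hlt)

end Dimension

end CQuasi

theorem mainTheorem11 {R : Type u} [CommRing R] [IsNoetherianRing R]
    (C : ModuleCat.{u} R) (hC : CQuasi.IsSemidualizing C)
    (M N : ModuleCat.{u} R) (hM : CQuasi.cqpd C M < ⊤) :
    ((∀ i : ℕ, 0 < i → CQuasi.TorVanishes C N i) →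
      (∃ n : ℕ, ∀ i : ℕ, n ≤ i → CQuasi.TorVanishes M N i) →
      ∀ i : ℕ, CQuasi.cqpd C M < ((i : ℝ) : EReal) → CQuasi.TorVanishes M N i) ∧
    ((∀ i : ℕ, 0 < i → CQuasi.ExtVanishes C N i) →
      (∃ n : ℕ, ∀ i : ℕ, n ≤ i → CQuasi.ExtVanishes M N i) →
      ∀ i : ℕ, CQuasi.cqpd C M < ((i : ℝ) : EReal) → CQuasi.ExtVanishes M N i) := by
  refine ⟨fun hT hev => (CQuasi.isVanishingFamily_torVanishes N).of_cqpd_lt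
    (fun P _ i hi => (hT i hi).tensor_left P) hev,
    fun hE hev => (CQuasi.isVanishingFamily_extVanishes N).of_cqpd_lt (fun P _ i hi => ?_) hev⟩
  obtain ⟨i, rfl⟩ : ∃ k, i = k + 1 := ⟨i - 1, by omega⟩
  exact (hE _ hi).tensor_left P
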